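/- Let $K$ be a number field with algebraic closure $\overline K$, let $b\in K$, $b\neq 0$, and let $E_1$ be the elliptic curve $y^2=x^3+bx$ over $K$. Let $K_7=K(E_1[7])\subset\overline K$ be the field generated over $K$ by the coordinates of all affine points $P\in E_1(\overline K)$ with $7P=O$. Let $i\in\overline K$ with $i^2=-1$ and let $\zeta=\zeta_7\in\overline K$ be a primitive 7th root of unity. Put $$\begin{aligned} \omega_1&=(6i+4)\zeta^5+(6i-2)\zeta^4+(2i-2)\zeta^3+(2i+4)\zeta^2+8i\zeta+4i-3,\\ \omega_3&=(2i+2)\zeta^5+6\zeta^4+(-4i+6)\zeta^3+(-6i+2)\zeta^2-4i\zeta-2i-1,\\ \omega_5&=(4i-6)\zeta^5+(-2i-4)\zeta^4+(6i-4)\zeta^3-6\zeta^2+4i\zeta+2i-7,\\ \theta_1&=\tfrac17\big((-3520i-1568)\zeta^5+(-4800i+2352)\zeta^4+(-256i+2352)\zeta^3+(-1536i-1568)\zeta^2-5056i\zeta-2528i+3584\big),\\ \theta_3&=\tfrac17\big((-256i-2352)\zeta^5+(1280i-3920)\zeta^4+(3264i-3920)\zeta^3+(4800i-2352)\zeta^2+4544i\zeta+2272i+1232\big),\\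 \theta_5&=\tfrac17\big((-3264i+3920)\zeta^5+(1536i+1568)\zeta^4+(-3520i+1568)\zeta^3+(1280i+3920)\zeta^2-1984i\zeta-992i+5152\big), \end{aligned}$$ and for $s\in\{1,3,5\}$ let $\omega_{s+1}$, $\theta_{s+1}$ be obtained from $\omega_s$, $\theta_s$ by the automorphism of $\mathbb Q(i,\zeta)$ with $i\mapsto -i$, $\zeta\mapsto\zeta$. Then the following hold. 1. For every $j\in\{1,\dots,6\}$, every sign $\varepsilon\in\{+1,-1\}$ and every choice of the square roots, put $$x=\sqrt{\omega_jb+\varepsilon\tfrac12 b\sqrt{\theta_j}},\qquad y=\sqrt{\Big(\omega_j+\varepsilon\tfrac12\sqrt{\theta_j}+1\Big)\,b\,x},$$ with the same $\sqrt{\theta_j}$ in both formulas. Then $(x,y)$ is a point of $E_1$ of exact order $7$, and $$K_7=K(i,\zeta_7,y).$$ 2. The $7$-division polynomial of $E_1$ is $q_7(x)=\tilde q_7(x^2)$, where $$\begin{aligned}\tilde q_7(t)={}&7t^{12}+308bt^{11}-2954b^2t^{10}-19852b^3t^9-35231b^4t^8-82264b^5t^7-111916b^6t^6\\&-42168b^7t^5+15673b^8t^4+14756b^9t^3+1302b^{10}t^2+196b^{11}t-b^{12};\end{aligned}$$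 an affine point $(x,y)\in E_1(\overline K)$ satisfies $7(x,y)=O$ if and only if $q_7(x)=0$. For every choice of the square roots $\sqrt{\theta_j}$, $$\tilde q_7(t)=7\prod_{j=1}^6\Big(t-\big(\omega_jb+\tfrac12b\sqrt{\theta_j}\big)\Big)\Big(t-\big(\omega_jb-\tfrac12b\sqrt{\theta_j}\big)\Big).$$ 3. Let $\phi_1(x,y)=(-x,iy)$ (and $\phi_1(O)=O$). For every point $P\in E_1(\overline K)$ of exact order $7$, $\{P,\phi_1(P)\}$ is a basis of $E_1[7]$ over $\mathbb Z/7\mathbb Z$. -/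

import Mathlib

noncomputable section

namespace SevenDivision

open Polynomial

/-- The curve `E₁ : y² = x³ + b x`. -/
def curve {K : Type*} [Field K] (b : K) : WeierstrassCurve K :=
  ⟨0, 0, 0, b, 0⟩

/-- The group `E₁(L)` of points of `E₁ : y² = x³ + b x` with coordinates in an extension `L`
of the base field. -/
abbrev Pt {K : Type*} [Field K] (b : K) (L : Type*) [Field L] [Algebra K L] : Type _ :=
  ((curve b).baseChange L).toAffine.Point

/-- The `m`-division field `K(E₁[m])`: the subfield of `L` generated over `K` by the coordinates
of the affine points of `E₁(L)` killed by `m` (for `L` an algebraic closure of `K`). -/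
def divisionField {K : Type*} [Field K] (b : K) (L : Type*) [Field L] [DecidableEq L]
    [Algebra K L] (m : ℕ) : IntermediateField K L :=
  IntermediateField.adjoin K
    {c : L | ∃ (x y : L) (h : ((curve b).baseChange L).toAffine.Nonsingular x y),
      m • (WeierstrassCurve.Affine.Point.some x y h : Pt b L) = 0 ∧ (c = x ∨ c = y)}

theorem nonsingular_cm {K : Type*} [Field K] {b : K} {L : Type*} [Field L] [Algebra K L]
    {i : L} (hi : i ^ 2 = -1) {x y : L}
    (h : ((curve b).baseChange L).toAffine.Nonsingular x y) :
    ((curve b).baseChange L).toAffine.Nonsingular (-x) (i * y) := by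
  have hi0 : i ≠ 0 := by
    rintro rfl
    simp at hi
  rw [WeierstrassCurve.Affine.nonsingular_iff', WeierstrassCurve.Affine.equation_iff] at h ⊢
  simp only [WeierstrassCurve.baseChange, WeierstrassCurve.map, curve, map_zero, zero_mul,
    mul_zero, add_zero, zero_sub, neg_ne_zero] at h ⊢
  refine ⟨by linear_combination (y ^ 2) * hi - h.1, h.2.imp (fun h => ?_) (fun h => ?_)⟩
  · simpa using h
  · intro h'
    exact h (mul_left_cancel₀ hi0 (by linear_combination h'))

/-- The complex multiplication `φ₁ (x, y) = (-x, i y)` of `E₁`, where `i² = -1`. -/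
def cm {K : Type*} [Field K] (b : K) {L : Type*} [Field L] [Algebra K L]
    (i : L) (hi : i ^ 2 = -1) : Pt b L → Pt b L
  | .zero => .zero
  | .some x y h => .some (-x) (i * y) (nonsingular_cm hi h)

/-- The polynomial of degree 12 in `t = x²` that gives the `7`-division polynomial of `E₁`. -/
def q7t {K : Type*} [Field K] (b : K) : K[X] :=
  7 * X ^ 12 + C (308 * b) * X ^ 11 - C (2954 * b ^ 2) * X ^ 10 - C (19852 * b ^ 3) * X ^ 9
    - C (35231 * b ^ 4) * X ^ 8 - C (82264 * b ^ 5) * X ^ 7 - C (111916 * b ^ 6) * X ^ 6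
    - C (42168 * b ^ 7) * X ^ 5 + C (15673 * b ^ 8) * X ^ 4 + C (14756 * b ^ 9) * X ^ 3
    + C (1302 * b ^ 10) * X ^ 2 + C (196 * b ^ 11) * X - C (b ^ 12)

/-- The `7`-division polynomial of `E₁`, of degree 24 in `x`. -/
def q7 {K : Type*} [Field K] (b : K) : K[X] :=
  (q7t b).comp (X ^ 2)

section Constants

variable {L : Type*} [Field L] (i z : L)

def omega1 : L :=
  (6 * i + 4) * z ^ 5 + (6 * i - 2) * z ^ 4 + (2 * i - 2) * z ^ 3 + (2 * i + 4) * z ^ 2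
    + 8 * i * z + 4 * i - 3

/-- The image of `omega1` under `i ↦ i`, `ζ₇ ↦ ζ₇⁵`. -/
def omega3 : L :=
  (2 * i + 2) * z ^ 5 + 6 * z ^ 4 + (-4 * i + 6) * z ^ 3 + (-6 * i + 2) * z ^ 2
    - 4 * i * z - 2 * i - 1

/-- The image of `omega3` under `i ↦ i`, `ζ₇ ↦ ζ₇⁵`. -/
def omega5 : L :=
  (4 * i - 6) * z ^ 5 + (-2 * i - 4) * z ^ 4 + (6 * i - 4) * z ^ 3 - 6 * z ^ 2
    + 4 * i * z + 2 * i - 7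

def theta1 : L :=
  (1 / 7) * ((-3520 * i - 1568) * z ^ 5 + (-4800 * i + 2352) * z ^ 4 + (-256 * i + 2352) * z ^ 3
    + (-1536 * i - 1568) * z ^ 2 - 5056 * i * z - 2528 * i + 3584)

/-- The image of `theta1` under `i ↦ i`, `ζ₇ ↦ ζ₇⁵`. -/
def theta3 : L :=
  (1 / 7) * ((-256 * i - 2352) * z ^ 5 + (1280 * i - 3920) * z ^ 4 + (3264 * i - 3920) * z ^ 3
    + (4800 * i - 2352) * z ^ 2 + 4544 * i * z + 2272 * i + 1232)

/-- The image of `theta3` under `i ↦ i`, `ζ₇ ↦ ζ₇⁵`. -/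
def theta5 : L :=
  (1 / 7) * ((-3264 * i + 3920) * z ^ 5 + (1536 * i + 1568) * z ^ 4 + (-3520 * i + 1568) * z ^ 3
    + (1280 * i + 3920) * z ^ 2 - 1984 * i * z - 992 * i + 5152)

/-- `ω₁, …, ω₆` (at the indices `0, …, 5`). For `s = 1, 3, 5`, `ω_{s+1}` is the conjugate of `ω_s`
under `i ↦ -i`, `ζ₇ ↦ ζ₇`; this equals the conjugate under `i ↦ i`, `ζ₇ ↦ ζ₇⁻¹`, because each
`ω_s` is fixed by `i ↦ -i`, `ζ₇ ↦ ζ₇⁻¹`. -/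
def omega : Fin 6 → L :=
  ![omega1 i z, omega1 (-i) z, omega3 i z, omega3 (-i) z, omega5 i z, omega5 (-i) z]

/-- `θ₁, …, θ₆` (at the indices `0, …, 5`), with the same conjugation as for `omega`. -/
def theta : Fin 6 → L :=
  ![theta1 i z, theta1 (-i) z, theta3 i z, theta3 (-i) z, theta5 i z, theta5 (-i) z]

end Constants

end SevenDivision

end

/-!
For `P ≠ 0`, the relation `7 P = 0` says that `3 P = ± 4 P`, i.e. that `3 P` and `4 P` have the
same abscissa; writing both abscissas as fractions in that of `P` turns this into `q₇(x) = 0`. As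
`q₇` has degree `24`, at most `48` affine points are killed by `7`. If `P` has order `7`, then the
`49` combinations `m P + n φ₁ P` are distinct, because `φ₁² = -1` and `-1` is not a square modulo
`7`, so they exhaust the `7`-torsion.

The quadratic factors of `q̃₇` that belong to `ω_s, θ_s` and to `ω_{s+1}, θ_{s+1}` are conjugate
under `i ↦ -i`, and their product has coefficients in the cubic field `ℚ(ζ₇ + ζ₇⁻¹)`. The three
products obtained in this way are conjugate, so `q̃₇` is a norm from that cubic field.

For a radical point put `t = ω_j ± √θ_j / 2`, so that `x² = t b` and `y² = (t + 1) b x`. Then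
`y⁴ = (t + 1)² t b³`, and as `t` is quadratic over `K(i, ζ₇)`, this is a linear equation for `t`
over `K(i, ζ₇, y)`. It is nondegenerate, so `t` and `x` lie in `K(i, ζ₇, y)`, and with them the
coordinates of all combinations of `P` and `φ₁ P`. Conversely, `K₇` contains `i = (i y) / y`, then
every `ω_j`, since the two values of `t b = x²` have sum `2 ω_j b`, and then `ζ₇`, which is a
`ℚ(i)`-linear combination of the `ω_j`.
-/

noncomputable section

namespace SevenDivision

open Polynomial WeierstrassCurve.Affine

theorem seven_nsmul_eq_zero_iff {A : Type*} [AddCommGroup A] {a : A} (ha : a ≠ 0) :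
    7 • a = 0 ↔ 3 • a = 4 • a ∨ 3 • a = -(4 • a : A) := by
  have h34 : ¬3 • a = 4 • a := by rwa [succ_nsmul a 3, left_eq_add]
  rw [or_iff_right h34, eq_neg_iff_add_eq_zero, ← add_nsmul]

section SquareRootOfNegOne

variable {A : Type*} [AddCommGroup A] {φ : A →+ A} {a : A} {p : ℕ}

theorem dvd_and_dvd_of_zsmul_add_zsmul_eq_zero (hφ : φ (φ a) = -a) (hp : p.Prime)
    (hp4 : p % 4 = 3) (ha : addOrderOf a = p) {m n : ℤ} (h : m • a + n • φ a = 0) :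
    (p : ℤ) ∣ m ∧ (p : ℤ) ∣ n := by
  have : Fact p.Prime := ⟨hp⟩
  have hφh : m • φ a - n • a = 0 := by
    simpa [hφ, sub_eq_add_neg] using congrArg φ h
  have hnorm : (m ^ 2 + n ^ 2) • a = 0 := by
    linear_combination (norm := module) m • h - n • hφh
  rw [← addOrderOf_dvd_iff_zsmul_eq_zero, ha, ← ZMod.intCast_zmod_eq_zero_iff_dvd] at hnorm
  push_cast at hnorm
  have hn : (n : ZMod p) = 0 := by
    by_contra hn
    exact ZMod.mod_four_ne_three_of_sq_eq_neg_sq' hn (eq_neg_of_add_eq_zero_left hnorm) hp4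
  have hm : (m : ZMod p) = 0 := by simpa [hn] using hnorm
  exact ⟨(ZMod.intCast_zmod_eq_zero_iff_dvd m p).mp hm,
    (ZMod.intCast_zmod_eq_zero_iff_dvd n p).mp hn⟩

theorem injective_nsmul_add_nsmul (hφ : φ (φ a) = -a) (hp : p.Prime) (hp4 : p % 4 = 3)
    (ha : addOrderOf a = p) :
    Function.Injective fun c : Fin p × Fin p => (c.1 : ℕ) • a + (c.2 : ℕ) • φ a := by
  rintro ⟨u, v⟩ ⟨u', v'⟩ (h : (u : ℕ) • a + (v : ℕ) • φ a = (u' : ℕ) • a + (v' : ℕ) • φ a)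
  have hsub : ((u : ℤ) - u') • a + ((v : ℤ) - v') • φ a = 0 := by
    simp only [sub_smul, natCast_zsmul]
    linear_combination (norm := module) h
  obtain ⟨hu, hv⟩ := dvd_and_dvd_of_zsmul_add_zsmul_eq_zero hφ hp hp4 ha hsub
  rw [← Int.modEq_iff_dvd, Int.natCast_modEq_iff] at hu hv
  ext
  · exact (hu.eq_of_lt_of_lt u'.2 u.2).symm
  · exact (hv.eq_of_lt_of_lt v'.2 v.2).symm

theorem nsmul_eq_zero_iff_existsUnique (hφ : φ (φ a) = -a) (hp : p.Prime) (hp4 : p % 4 = 3)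
    (ha : addOrderOf a = p) (hcard : {q : A | p • q = 0}.encard ≤ p ^ 2) (q : A) :
    p • q = 0 ↔ ∃! c : Fin p × Fin p, q = (c.1 : ℕ) • a + (c.2 : ℕ) • φ a := by
  have hpa : p • a = 0 := ha ▸ addOrderOf_nsmul_eq_zero a
  have hinj := injective_nsmul_add_nsmul hφ hp hp4 ha
  have hrange : Set.range (fun c : Fin p × Fin p => (c.1 : ℕ) • a + (c.2 : ℕ) • φ a) =
      {q : A | p • q = 0} := by
    refine Set.Finite.eq_of_subset_of_encard_le (Set.finite_range _) ?_ ?_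
    · rintro _ ⟨c, rfl⟩
      simp only [Set.mem_ofPred_eq, nsmul_add, smul_comm p, ← map_nsmul φ p, hpa, map_zero,
        smul_zero, add_zero]
    · rw [← Set.image_univ, hinj.encard_image, Set.encard_univ]
      simpa [sq] using hcard
  change q ∈ {q : A | p • q = 0} ↔ _
  rw [← hrange]
  constructor
  · rintro ⟨c, rfl⟩
    exact ⟨c, rfl, fun c' h => (hinj h).symm⟩
  · rintro ⟨c, rfl, -⟩
    exact ⟨c, rfl⟩

end SquareRootOfNegOne

section Abscissa

variable {F : Type*} [Field F] {W : WeierstrassCurve.Affine F}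

/-- `(X : Z)` are homogeneous coordinates in `ℙ¹` of the abscissa of `P`, where the abscissa of
the point at infinity is `(1 : 0)`. This lets the multiplication formulas for abscissas be stated
without excluding the points at which their denominators vanish. -/
def HasAbscissa : W.Point → F → F → Prop
  | .zero, X, Z => X ≠ 0 ∧ Z = 0
  | .some x _ _, X, Z => Z ≠ 0 ∧ X = x * Z

theorem hasAbscissa_zero_iff {X Z : F} : HasAbscissa (0 : W.Point) X Z ↔ X ≠ 0 ∧ Z = 0 :=
  Iff.rfl

theorem hasAbscissa_some_iff {x y X Z : F} {h : W.Nonsingular x y} :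
    HasAbscissa (Point.some x y h) X Z ↔ Z ≠ 0 ∧ X = x * Z :=
  Iff.rfl

theorem HasAbscissa.eq_or_eq_neg_iff {P Q : W.Point} {X Z X' Z' : F} (hP : HasAbscissa P X Z)
    (hQ : HasAbscissa Q X' Z') : P = Q ∨ P = -Q ↔ X * Z' = X' * Z := by
  rcases P with _ | ⟨x, y, h⟩ <;> rcases Q with _ | ⟨x', y', h'⟩
  · simp [hP.2, hQ.2]
  · simp [hP.1, hP.2, hQ.1, ← Point.zero_def]
  · simp [hP.1, hQ.1, hQ.2, ← Point.zero_def]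
  · obtain ⟨hZ, rfl⟩ := hP
    obtain ⟨hZ', rfl⟩ := hQ
    rw [← Point.X_eq_iff, mul_assoc, mul_assoc, mul_comm Z' Z, mul_left_inj' (mul_ne_zero hZ hZ')]

theorem encard_points_eval_eq_zero_le {p : F[X]} (hp : p ≠ 0) :
    {P : W.Point | ∃ x y h, P = Point.some x y h ∧ p.eval x = 0}.encard ≤ 2 * p.natDegree := by
  classical
  set R : Set F := ↑p.roots.toFinset
  have hR : R.encard ≤ p.natDegree := by
    rw [Set.encard_coe_eq_coe_finsetCard]
    exact_mod_cast (Multiset.toFinset_card_le _).trans p.card_roots'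
  let lift (x : F) : W.Point := Classical.epsilon fun P => ∃ y h, P = Point.some x y h
  have hsub : {P : W.Point | ∃ x y h, P = Point.some x y h ∧ p.eval x = 0} ⊆
      lift '' R ∪ (-lift) '' R := by
    rintro _ ⟨x, y, h, rfl, hx⟩
    have hxR : x ∈ R := by simpa [R, hp] using hx
    obtain ⟨y', h', hlift⟩ : ∃ y' h', lift x = Point.some x y' h' :=
      Classical.epsilon_spec (p := fun P : W.Point => ∃ y' h', P = Point.some x y' h')
        ⟨_, y, h, rfl⟩
    rcases Point.X_eq_iff.mp (rfl : x = x) with heq | heq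
    · exact .inl ⟨x, hxR, hlift.trans heq⟩
    · exact .inr ⟨x, hxR, by rw [Pi.neg_apply, hlift, heq, neg_neg]⟩
  refine (Set.encard_le_encard hsub).trans <| (Set.encard_union_le _ _).trans ?_
  rw [two_mul]
  exact add_le_add ((Set.encard_image_le _ _).trans hR) ((Set.encard_image_le _ _).trans hR)

end Abscissa

section Multiples

variable {K : Type*} [Field K] {b : K} {L : Type*} [Field L] [Algebra K L]

theorem equation_curve_iff {x y : L} :
    ((curve b).baseChange L).toAffine.Equation x y ↔ y ^ 2 = x ^ 3 + algebraMap K L b * x := by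
  simp [equation_iff, curve]

theorem negY_curve (x y : L) : ((curve b).baseChange L).toAffine.negY x y = -y := by
  simp [negY, curve]

theorem nonsingular_curve_of_equation (h2 : (2 : L) ≠ 0) (hb : b ≠ 0) {x y : L}
    (h : y ^ 2 = x ^ 3 + algebraMap K L b * x) :
    ((curve b).baseChange L).toAffine.Nonsingular x y := by
  have hΔ : ((curve b).baseChange L).Δ = -(2 ^ 6 * algebraMap K L b ^ 3) := by
    simp [curve, WeierstrassCurve.Δ, WeierstrassCurve.b₂, WeierstrassCurve.b₄,
      WeierstrassCurve.b₆, WeierstrassCurve.b₈]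
    ring
  refine (equation_iff_nonsingular_of_Δ_ne_zero ?_).mp (equation_curve_iff.mpr h)
  change ((curve b).baseChange L).Δ ≠ 0
  rw [hΔ, neg_ne_zero]
  exact mul_ne_zero (pow_ne_zero _ h2) (pow_ne_zero _ ((_root_.map_ne_zero _).mpr hb))

theorem addX_curve (x₁ x₂ ℓ : L) :
    ((curve b).baseChange L).toAffine.addX x₁ x₂ ℓ = ℓ ^ 2 - x₁ - x₂ := by
  simp [addX, curve]

theorem aeval_q7 (x : L) : aeval x (q7 b) = (q7t (algebraMap K L b)).eval (x ^ 2) := by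
  simp [q7, q7t, _root_.map_ofNat]

theorem q7t_ne_zero {β : L} (hβ : β ≠ 0) : q7t β ≠ 0 := by
  intro h
  refine pow_ne_zero 12 hβ ?_
  simpa [q7t] using congrArg (eval 0) h

theorem natDegree_q7_le : (q7 b).natDegree ≤ 24 := by
  have : (q7t b).natDegree ≤ 12 := by
    unfold q7t
    compute_degree
  rw [q7, natDegree_comp, natDegree_X_pow]
  lia

variable [DecidableEq L]

theorem slope_curve_of_add_ne_zero {x y₁ y₂ : L} (hy : y₁ + y₂ ≠ 0) :
    ((curve b).baseChange L).toAffine.slope x x y₁ y₂ =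
      (3 * x ^ 2 + algebraMap K L b) / (2 * y₁) := by
  have hne : y₁ ≠ ((curve b).baseChange L).toAffine.negY x y₂ := by
    rwa [negY_curve, Ne, eq_neg_iff_add_eq_zero]
  rw [slope_of_Y_ne rfl hne, negY_curve]
  simp [curve, two_mul]

theorem two_nsmul_some_of_Y_eq_zero {x : L}
    (h : ((curve b).baseChange L).toAffine.Nonsingular x 0) :
    2 • (Point.some x 0 h : Pt b L) = 0 := by
  rw [two_nsmul]
  exact Point.add_self_of_Y_eq (by rw [negY_curve, neg_zero])

theorem exists_two_nsmul_some_eq (h2 : (2 : L) ≠ 0) {x y : L}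
    (h : ((curve b).baseChange L).toAffine.Nonsingular x y) (hy : y ≠ 0) :
    ∃ x' y' h', 2 • (Point.some x y h : Pt b L) = Point.some x' y' h' ∧
      (x ^ 2 - algebraMap K L b) ^ 2 = x' * (4 * y ^ 2) := by
  have hxy := equation_curve_iff.mp h.1
  have hyy : y + y ≠ 0 := by
    rw [← two_mul]
    exact mul_ne_zero h2 hy
  have hne : y ≠ ((curve b).baseChange L).toAffine.negY x y := by
    rwa [negY_curve, Ne, eq_neg_iff_add_eq_zero]
  refine ⟨_, _, _, (two_nsmul _).trans (Point.add_self_of_Y_ne hne), ?_⟩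
  rw [slope_curve_of_add_ne_zero hyy, addX_curve]
  field_simp
  linear_combination (32 * x) * hxy

theorem X_add_mul_X_sub {x₁ y₁ x₂ y₂ x₃ y₃ x₄ y₄ : L}
    {h₁ : ((curve b).baseChange L).toAffine.Nonsingular x₁ y₁}
    {h₂ : ((curve b).baseChange L).toAffine.Nonsingular x₂ y₂}
    {h₃ : ((curve b).baseChange L).toAffine.Nonsingular x₃ y₃}
    {h₄ : ((curve b).baseChange L).toAffine.Nonsingular x₄ y₄} (hx : x₁ ≠ x₂)
    (hadd : Point.some x₁ y₁ h₁ + Point.some x₂ y₂ h₂ = Point.some x₃ y₃ h₃)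
    (hsub : Point.some x₁ y₁ h₁ - Point.some x₂ y₂ h₂ = Point.some x₄ y₄ h₄) :
    x₃ * x₄ * (x₁ - x₂) ^ 2 = (x₁ * x₂ - algebraMap K L b) ^ 2 := by
  have e₁ := equation_curve_iff.mp h₁.1
  have e₂ := equation_curve_iff.mp h₂.1
  rw [Point.add_of_X_ne hx, Point.some.injEq] at hadd
  rw [sub_eq_add_neg, Point.neg_some, Point.add_of_X_ne hx, Point.some.injEq] at hsub
  have hd : x₁ - x₂ ≠ 0 := sub_ne_zero.mpr hx
  have h₃' : x₃ * (x₁ - x₂) ^ 2 = (y₁ - y₂) ^ 2 - (x₁ + x₂) * (x₁ - x₂) ^ 2 := by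
    rw [← hadd.1, slope_of_X_ne hx, addX_curve]
    field_simp
    ring
  have h₄' : x₄ * (x₁ - x₂) ^ 2 = (y₁ + y₂) ^ 2 - (x₁ + x₂) * (x₁ - x₂) ^ 2 := by
    rw [← hsub.1, slope_of_X_ne hx, addX_curve, negY_curve]
    field_simp
    ring
  refine mul_right_cancel₀ (pow_ne_zero 2 hd) ?_
  linear_combination x₄ * (x₁ - x₂) ^ 2 * h₃' +
    ((y₁ - y₂) ^ 2 - (x₁ + x₂) * (x₁ - x₂) ^ 2) * h₄' +
    (e₁ - e₂) * (y₁ ^ 2 - y₂ ^ 2 + (x₁ ^ 3 + algebraMap K L b * x₁) -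
      (x₂ ^ 3 + algebraMap K L b * x₂)) - 2 * (x₁ + x₂) * (x₁ - x₂) ^ 2 * (e₁ + e₂)

theorem HasAbscissa.two_nsmul (h2 : (2 : L) ≠ 0) (hb : b ≠ 0) {P : Pt b L} {X Z : L}
    (hP : HasAbscissa P X Z) :
    HasAbscissa (2 • P) ((X ^ 2 - algebraMap K L b * Z ^ 2) ^ 2)
      (4 * X * Z * (X ^ 2 + algebraMap K L b * Z ^ 2)) := by
  have hβ : algebraMap K L b ≠ 0 := (_root_.map_ne_zero _).mpr hb
  rcases P with _ | ⟨x, y, h⟩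
  · obtain ⟨hX, rfl⟩ := hP
    rw [← Point.zero_def, nsmul_zero, hasAbscissa_zero_iff]
    simp [hX]
  obtain ⟨hZ, rfl⟩ := hP
  have hxy := equation_curve_iff.mp h.1
  by_cases hy : y = 0
  · subst hy
    rw [two_nsmul_some_of_Y_eq_zero, hasAbscissa_zero_iff]
    refine ⟨pow_ne_zero 2 fun h0 => ?_, by linear_combination (-4 * Z ^ 4) * hxy⟩
    have hxβ : x ^ 2 - algebraMap K L b = 0 :=
      (mul_eq_zero.mp (by linear_combination h0 :
        (x ^ 2 - algebraMap K L b) * Z ^ 2 = 0)).resolve_right (pow_ne_zero 2 hZ)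
    have hx : x = 0 := by
      have : 2 * algebraMap K L b * x = 0 := by linear_combination -hxy - x * hxβ
      simpa [h2, hβ] using this
    exact hβ (by linear_combination x * hx - hxβ)
  · obtain ⟨x', y', h', hdouble, e⟩ := exists_two_nsmul_some_eq h2 h hy
    rw [hdouble, hasAbscissa_some_iff]
    have hden : 4 * (x * Z) * Z * ((x * Z) ^ 2 + algebraMap K L b * Z ^ 2) =
        2 ^ 2 * y ^ 2 * Z ^ 4 := by
      linear_combination (-4 * Z ^ 4) * hxy
    rw [hden]
    exact ⟨by positivity, by linear_combination Z ^ 4 * e⟩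

theorem hasAbscissa_three_nsmul_some_of_Y_ne_zero (h2 : (2 : L) ≠ 0) (hb : b ≠ 0) {x y : L}
    (h : ((curve b).baseChange L).toAffine.Nonsingular x y) (hy : y ≠ 0) :
    HasAbscissa (3 • (Point.some x y h : Pt b L))
      (x * (x ^ 4 - 6 * algebraMap K L b * x ^ 2 - 3 * algebraMap K L b ^ 2) ^ 2)
      ((3 * x ^ 4 + 6 * algebraMap K L b * x ^ 2 - algebraMap K L b ^ 2) ^ 2) := by
  obtain ⟨x₂, y₂, h₂, hdouble, e₂⟩ := exists_two_nsmul_some_eq h2 h hy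
  set β := algebraMap K L b
  set g := x ^ 4 - 6 * β * x ^ 2 - 3 * β ^ 2 with hg
  set ψ := 3 * x ^ 4 + 6 * β * x ^ 2 - β ^ 2 with hψ
  have hxy : y ^ 2 = x ^ 3 + β * x := equation_curve_iff.mp h.1
  have hx0 : x ≠ 0 := by
    rintro rfl
    exact hy (by simpa using hxy)
  have hψ₂ : (x₂ - x) * (4 * y ^ 2) = -ψ := by
    linear_combination -e₂ - 4 * x * hxy - hψ
  have hg₂ : (x₂ * x - β) * (4 * y ^ 2) = x * g := by
    linear_combination -x * e₂ - 4 * β * hxy - x * hg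
  have hzero : x₂ = x ↔ 3 • (Point.some x y h : Pt b L) = 0 := by
    rw [Point.X_eq_iff (h₁ := h₂) (h₂ := h), ← hdouble, two_nsmul, add_eq_left,
      or_iff_right (Point.some_ne_zero h), eq_neg_iff_add_eq_zero, ← two_nsmul, ← succ_nsmul]
  rcases htriple : 3 • (Point.some x y h : Pt b L) with _ | ⟨x₃, y₃, h₃⟩
  · obtain rfl := hzero.mpr htriple
    have hψ0 : ψ = 0 := by linear_combination hψ₂
    refine ⟨mul_ne_zero hx0 (pow_ne_zero 2 fun hg0 => ?_), by rw [hψ0, zero_pow two_ne_zero]⟩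
    have hβ : β ≠ 0 := (_root_.map_ne_zero _).mpr hb
    refine mul_ne_zero (pow_ne_zero 6 h2) (pow_ne_zero 3 hβ) ?_
    linear_combination (3 * x₂ ^ 2 - β) * (hψ0 - 3 * hg0) - 18 * β * (hψ0 + hg0) +
      (3 * x₂ ^ 2 - 19 * β) * hψ - (9 * x₂ ^ 2 + 15 * β) * hg
  · have hne : x₂ ≠ x := fun hx => Point.some_ne_zero h₃ (htriple ▸ hzero.mp hx)
    have e₃ : x₃ * x * (x₂ - x) ^ 2 = (x₂ * x - β) ^ 2 := by
      refine X_add_mul_X_sub (h₁ := h₂) (h₂ := h) (h₃ := h₃) (h₄ := h) hne ?_ ?_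
      · rw [← hdouble, ← htriple, ← succ_nsmul]
      · rw [← hdouble, two_nsmul, add_sub_cancel_right]
    rw [hasAbscissa_some_iff]
    refine ⟨pow_ne_zero 2 ?_, mul_left_cancel₀ hx0 ?_⟩
    · rw [← neg_ne_zero, ← hψ₂, (by ring : 4 * y ^ 2 = (2 * y) ^ 2)]
      exact mul_ne_zero (sub_ne_zero.mpr hne) (pow_ne_zero 2 (mul_ne_zero h2 hy))
    · linear_combination -((x₂ * x - β) * (4 * y ^ 2) + x * g) * hg₂ - (4 * y ^ 2) ^ 2 * e₃ +
        x₃ * x * ((x₂ - x) * (4 * y ^ 2) - ψ) * hψ₂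

theorem hasAbscissa_three_nsmul_some (h2 : (2 : L) ≠ 0) (hb : b ≠ 0) {x y : L}
    (h : ((curve b).baseChange L).toAffine.Nonsingular x y) :
    HasAbscissa (3 • (Point.some x y h : Pt b L))
      (x * (x ^ 4 - 6 * algebraMap K L b * x ^ 2 - 3 * algebraMap K L b ^ 2) ^ 2)
      ((3 * x ^ 4 + 6 * algebraMap K L b * x ^ 2 - algebraMap K L b ^ 2) ^ 2) := by
  by_cases hy : y = 0
  · subst hy
    have hβ : algebraMap K L b ≠ 0 := (_root_.map_ne_zero _).mpr hb
    have hcubic : x * (x ^ 2 + algebraMap K L b) = 0 := by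
      linear_combination -equation_curve_iff.mp h.1
    rw [succ_nsmul, two_nsmul_some_of_Y_eq_zero, zero_add, hasAbscissa_some_iff]
    refine ⟨pow_ne_zero 2 fun hψ => ?_, by
      linear_combination (-8 * (x ^ 2 - algebraMap K L b) *
        (x ^ 4 + 6 * algebraMap K L b * x ^ 2 + algebraMap K L b ^ 2)) * hcubic⟩
    rcases mul_eq_zero.mp hcubic with rfl | hx
    · exact pow_ne_zero 2 hβ (by linear_combination -hψ)
    · exact mul_ne_zero (pow_ne_zero 2 h2) (pow_ne_zero 2 hβ)
        (by linear_combination 3 * (x ^ 2 + algebraMap K L b) * hx - hψ)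
  · exact hasAbscissa_three_nsmul_some_of_Y_ne_zero h2 hb h hy

theorem seven_nsmul_some_eq_zero_iff (h2 : (2 : L) ≠ 0) (hb : b ≠ 0) {x y : L}
    (h : ((curve b).baseChange L).toAffine.Nonsingular x y) :
    7 • (Point.some x y h : Pt b L) = 0 ↔ aeval x (q7 b) = 0 := by
  have hP : HasAbscissa (Point.some x y h : Pt b L) x 1 :=
    hasAbscissa_some_iff.mpr ⟨one_ne_zero, (mul_one x).symm⟩
  have hP₄ := (hP.two_nsmul h2 hb).two_nsmul h2 hb
  rw [← mul_nsmul] at hP₄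
  rw [seven_nsmul_eq_zero_iff (Point.some_ne_zero h),
    (hasAbscissa_three_nsmul_some h2 hb h).eq_or_eq_neg_iff hP₄, aeval_q7, ← sub_eq_zero]
  refine Eq.congr_left ?_
  simp only [q7t, eval_add, eval_sub, eval_mul, eval_pow, eval_X, eval_C, eval_ofNat]
  ring

theorem addOrderOf_some_eq_seven_iff (h2 : (2 : L) ≠ 0) (hb : b ≠ 0) {x y : L}
    (h : ((curve b).baseChange L).toAffine.Nonsingular x y) :
    addOrderOf (Point.some x y h : Pt b L) = 7 ↔ aeval x (q7 b) = 0 := by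
  have : Fact (Nat.Prime 7) := ⟨by norm_num⟩
  rw [← seven_nsmul_some_eq_zero_iff h2 hb h, addOrderOf_eq_prime_iff,
    and_iff_left (Point.some_ne_zero h)]

theorem encard_seven_torsion_le (h2 : (2 : L) ≠ 0) (hb : b ≠ 0) :
    {P : Pt b L | 7 • P = 0}.encard ≤ 7 ^ 2 := by
  set p : L[X] := (q7 b).map (algebraMap K L) with hp
  have hp0 : p ≠ 0 := (Polynomial.map_ne_zero_iff (algebraMap K L).injective).mpr fun h0 =>
    q7t_ne_zero hb (comp_eq_zero_iff.mp h0 |>.resolve_right (by simp))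
  have hdeg : p.natDegree ≤ 24 := natDegree_map_le.trans natDegree_q7_le
  have hsub : {P : Pt b L | 7 • P = 0} ⊆
      insert 0 {P : Pt b L | ∃ x y h, P = Point.some x y h ∧ p.eval x = 0} := by
    rintro (_ | ⟨x, y, h⟩) hP
    · exact .inl rfl
    · refine .inr ⟨x, y, h, rfl, ?_⟩
      rwa [hp, eval_map_algebraMap, ← seven_nsmul_some_eq_zero_iff h2 hb h]
  calc {P : Pt b L | 7 • P = 0}.encard
      ≤ {P : Pt b L | ∃ x y h, P = Point.some x y h ∧ p.eval x = 0}.encard + 1 :=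
        (Set.encard_le_encard hsub).trans (Set.encard_insert_le _ _)
    _ ≤ 2 * p.natDegree + 1 := by gcongr; exact encard_points_eval_eq_zero_le hp0
    _ ≤ 7 ^ 2 := by norm_cast; lia

end Multiples

theorem preΨ'_seven_curve {K : Type*} [Field K] (b : K) : (curve b).preΨ' 7 = q7 b := by
  have h5 : (curve b).preΨ' 5 =
      (curve b).preΨ₄ * (curve b).Ψ₂Sq ^ 2 - (curve b).Ψ₃ ^ 3 := by
    simpa using (curve b).preΨ'_odd 0
  have h7 : (curve b).preΨ' 7 = (curve b).preΨ' 5 * (curve b).Ψ₃ ^ 3 -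
      (curve b).preΨ₄ ^ 3 * (curve b).Ψ₂Sq ^ 2 := by
    simpa using (curve b).preΨ'_odd 1
  rw [h7, h5, q7, q7t]
  simp only [WeierstrassCurve.preΨ₄, WeierstrassCurve.Ψ₃, WeierstrassCurve.Ψ₂Sq,
    WeierstrassCurve.b₂, WeierstrassCurve.b₄, WeierstrassCurve.b₆, WeierstrassCurve.b₈, curve,
    map_add, map_sub, map_mul, map_pow, map_zero, map_ofNat, add_comp, sub_comp, mul_comp,
    pow_comp, X_comp, C_comp, ofNat_comp]
  ring

section ComplexMultiplication

variable {K : Type*} [Field K] {b : K} {L : Type*} [Field L] [Algebra K L] {i : L}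

theorem ne_zero_of_sq_eq_neg_one (hi : i ^ 2 = -1) : i ≠ 0 := by
  rintro rfl
  simp at hi

variable [DecidableEq L]

theorem slope_cm (hi : i ^ 2 = -1) {x₁ x₂ y₁ y₂ : L} (hxy : ¬(x₁ = x₂ ∧ y₁ = -y₂)) :
    ((curve b).baseChange L).toAffine.slope (-x₁) (-x₂) (i * y₁) (i * y₂) =
      -i * ((curve b).baseChange L).toAffine.slope x₁ x₂ y₁ y₂ := by
  have hi0 : i ≠ 0 := ne_zero_of_sq_eq_neg_one hi
  have hinv : i⁻¹ = -i := inv_eq_of_mul_eq_one_right (by linear_combination -hi)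
  by_cases hx : x₁ = x₂
  · subst hx
    have hy : y₁ + y₂ ≠ 0 := fun h => hxy ⟨rfl, eq_neg_of_add_eq_zero_left h⟩
    have hy' : i * y₁ + i * y₂ ≠ 0 := by
      rw [← mul_add]
      exact mul_ne_zero hi0 hy
    rw [slope_curve_of_add_ne_zero hy, slope_curve_of_add_ne_zero hy', neg_sq, mul_left_comm,
      ← div_div, div_right_comm, div_eq_mul_inv _ i, hinv, mul_comm]
  · rw [slope_of_X_ne hx, slope_of_X_ne (neg_inj.not.mpr hx), ← mul_sub, ← neg_sub', div_neg,
      mul_div_assoc, neg_mul]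

theorem cm_add (hi : i ^ 2 = -1) (P Q : Pt b L) :
    cm b i hi (P + Q) = cm b i hi P + cm b i hi Q := by
  rcases P with _ | ⟨x₁, y₁, h₁⟩
  · change cm b i hi (0 + Q) = 0 + cm b i hi Q
    rw [zero_add, zero_add]
  rcases Q with _ | ⟨x₂, y₂, h₂⟩
  · change cm b i hi (_ + 0) = _ + 0
    rw [add_zero, add_zero]
  by_cases hxy : x₁ = x₂ ∧ y₁ = -y₂
  · obtain ⟨rfl, rfl⟩ := hxy
    rw [Point.add_of_Y_eq rfl (negY_curve _ _).symm]
    simp only [cm]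
    rw [Point.add_of_Y_eq rfl (by rw [negY_curve, mul_neg])]
    rfl
  · have hi0 : i ≠ 0 := ne_zero_of_sq_eq_neg_one hi
    have hxy' : ¬(-x₁ = -x₂ ∧ i * y₁ = -(i * y₂)) := by
      rwa [neg_inj, ← mul_neg, mul_right_inj' hi0]
    rw [Point.add_some (by rwa [negY_curve])]
    simp only [cm]
    rw [Point.add_some (by rwa [negY_curve]), Point.some.injEq, slope_cm hi hxy]
    simp only [addY, negAddY, addX_curve, negY_curve]
    generalize ((curve b).baseChange L).toAffine.slope x₁ x₂ y₁ y₂ = ℓ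
    exact ⟨by linear_combination -ℓ ^ 2 * hi, by linear_combination (-i * ℓ ^ 3) * hi⟩

/-- The complex multiplication `cm` as an endomorphism of the group of points. -/
def cmHom (b : K) (hi : i ^ 2 = -1) : Pt b L →+ Pt b L where
  toFun := cm b i hi
  map_zero' := rfl
  map_add' := cm_add hi

theorem cmHom_cmHom (hi : i ^ 2 = -1) (P : Pt b L) : cmHom b hi (cmHom b hi P) = -P := by
  rcases P with _ | ⟨x, y, h⟩
  · rfl
  · change Point.some _ _ _ = _
    rw [Point.neg_some, Point.some.injEq, negY_curve]
    exact ⟨neg_neg x, by linear_combination y * hi⟩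

theorem seven_nsmul_eq_zero_iff_existsUnique_cm (h2 : (2 : L) ≠ 0) (hb : b ≠ 0)
    (hi : i ^ 2 = -1) {P : Pt b L} (hP : addOrderOf P = 7) (Q : Pt b L) :
    7 • Q = 0 ↔ ∃! c : Fin 7 × Fin 7, Q = (c.1 : ℕ) • P + (c.2 : ℕ) • cm b i hi P :=
  nsmul_eq_zero_iff_existsUnique (φ := cmHom b hi) (cmHom_cmHom hi P) (by norm_num) rfl hP
    (encard_seven_torsion_le h2 hb) Q

end ComplexMultiplication

theorem map_omega {F L : Type*} [Field F] [Field L] (f : F →+* L) (i z : F) (j : Fin 6) :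
    f (omega i z j) = omega (f i) (f z) j := by
  fin_cases j <;> simp [omega, omega1, omega3, omega5, map_ofNat]

theorem map_theta {F L : Type*} [Field F] [Field L] (f : F →+* L) (i z : F) (j : Fin 6) :
    f (theta i z j) = theta (f i) (f z) j := by
  fin_cases j <;> simp [theta, theta1, theta3, theta5, map_ofNat]

theorem map_q7t {K L : Type*} [Field K] [Field L] (f : K →+* L) (b : K) :
    (q7t b).map f = q7t (f b) := by
  simp [q7t, map_ofNat]

section Constants

variable {F : Type*} [Field F] {i z : F}

theorem eq_linear_combination_omega (hi : i ^ 2 = -1) :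
    1232 * z = (2 - 55 * i) * omega i z 0 + (2 + 55 * i) * omega i z 1 +
      (-20 + 33 * i) * omega i z 2 + (-20 - 33 * i) * omega i z 3 +
      (46 - 11 * i) * omega i z 4 + (46 + 11 * i) * omega i z 5 := by
  simp only [omega, omega1, omega3, omega5, Matrix.cons_val]
  linear_combination (616 * z ^ 5 + 616 * z ^ 4 + 616 * z ^ 3 + 616 * z ^ 2 + 1232 * z + 616) * hi

theorem cyclotomic_seven_eq_zero (hz : IsPrimitiveRoot z 7) :
    z ^ 6 + z ^ 5 + z ^ 4 + z ^ 3 + z ^ 2 + z + 1 = 0 := by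
  refine mul_left_cancel₀ (sub_ne_zero.mpr (hz.ne_one (by norm_num))) ?_
  linear_combination hz.pow_eq_one

theorem omega3_eq_omega1 (hz : IsPrimitiveRoot z 7) : omega3 i z = omega1 i (z ^ 5) := by
  have := cyclotomic_seven_eq_zero hz
  simp only [omega1, omega3]
  grind

theorem omega5_eq_omega1 (hz : IsPrimitiveRoot z 7) : omega5 i z = omega1 i (z ^ 3) := by
  have := cyclotomic_seven_eq_zero hz
  simp only [omega1, omega5]
  grind

theorem theta3_eq_theta1 (hz : IsPrimitiveRoot z 7) : theta3 i z = theta1 i (z ^ 5) := by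
  have := cyclotomic_seven_eq_zero hz
  simp only [theta1, theta3]
  grind

theorem theta5_eq_theta1 (hz : IsPrimitiveRoot z 7) : theta5 i z = theta1 i (z ^ 3) := by
  have := cyclotomic_seven_eq_zero hz
  simp only [theta1, theta5]
  grind

/-- The norm to `ℚ` of `u + v c + w c²`, where `c = ζ₇ + ζ₇⁻¹` is a root of
`c³ + c² - 2 c - 1`. -/
def cubicNorm (u v w : F) : F :=
  u ^ 3 - u ^ 2 * v + 5 * u ^ 2 * w - 2 * u * v ^ 2 - u * v * w + 6 * u * w ^ 2 +
    v ^ 3 - v ^ 2 * w - 2 * v * w ^ 2 + w ^ 3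

theorem prod_eq_cubicNorm (hz : IsPrimitiveRoot z 7) (u v w : F) :
    (u + v * (z + z ^ 6) + w * (z + z ^ 6) ^ 2) *
        (u + v * (z ^ 5 + (z ^ 5) ^ 6) + w * (z ^ 5 + (z ^ 5) ^ 6) ^ 2) *
        (u + v * (z ^ 3 + (z ^ 3) ^ 6) + w * (z ^ 3 + (z ^ 3) ^ 6) ^ 2) = cubicNorm u v w := by
  have hΦ := cyclotomic_seven_eq_zero hz
  generalize hc₁ : z + z ^ 6 = c₁
  generalize hc₂ : z ^ 5 + (z ^ 5) ^ 6 = c₂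
  generalize hc₃ : z ^ 3 + (z ^ 3) ^ 6 = c₃
  have h₁ : c₁ + c₂ + c₃ = -1 := by grind
  have h₂ : c₁ * c₂ + c₁ * c₃ + c₂ * c₃ = -2 := by grind
  have h₃ : c₁ * c₂ * c₃ = 1 := by grind
  clear hc₁ hc₂ hc₃ hΦ hz
  rw [cubicNorm]
  grind

section Cosine

-- `c` and `d` generate the fixed field of `i ↦ -i, z ↦ z⁻¹`, which contains all `omega i z j` and
-- `theta i z j`, and `d ↦ -d` corresponds to `i ↦ -i`.
variable {c d : F}

theorem cubic_eq (hz : IsPrimitiveRoot z 7) (hc : c = z + z ^ 6) :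
    c ^ 3 + c ^ 2 - 2 * c - 1 = 0 := by
  subst hc
  linear_combination
    (z ^ 12 - z ^ 11 + 3 * z ^ 7 - 2 * z ^ 6 - z ^ 4 + 3 * z ^ 2 - z - 1) *
      cyclotomic_seven_eq_zero hz

theorem sq_eq (hi : i ^ 2 = -1) (hz : IsPrimitiveRoot z 7) (hc : c = z + z ^ 6)
    (hd : d = i * (z - z ^ 6)) : d ^ 2 = 4 - c ^ 2 := by
  subst hc hd
  linear_combination
    (z ^ 12 - 2 * z ^ 7 + z ^ 2) * hi + (4 * z - 4) * cyclotomic_seven_eq_zero hz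

theorem omega1_eq (hz : IsPrimitiveRoot z 7) (hc : c = z + z ^ 6) (hd : d = i * (z - z ^ 6)) :
    omega1 i z = 6 * c ^ 2 + 2 * c - 13 + d * (-2 * c ^ 2 - 2 * c + 6) := by
  have := cyclotomic_seven_eq_zero hz
  subst hc hd
  rw [omega1]
  grind

variable [CharZero F]

theorem theta1_eq (hz : IsPrimitiveRoot z 7) (hc : c = z + z ^ 6) (hd : d = i * (z - z ^ 6)) :
    theta1 i z =
      1 / 7 * (-3920 * c ^ 2 - 2352 * c + 9072 + d * (2272 * c ^ 2 + 992 * c - 4800)) := by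
  have := cyclotomic_seven_eq_zero hz
  subst hc hd
  rw [theta1]
  grind

theorem omega1_sq_sub_theta1 (hi : i ^ 2 = -1) (hz : IsPrimitiveRoot z 7)
    (hc : c = z + z ^ 6) (hd : d = i * (z - z ^ 6)) :
    omega1 i z ^ 2 - theta1 i z / 4 =
      1 / 7 * (28 * c ^ 2 + 28 * c - 77 + d * (-36 * c ^ 2 + 4 * c + 52)) := by
  rw [omega1_eq hz hc hd, theta1_eq hz hc hd]
  linear_combination
    (4 * c ^ 4 + 8 * c ^ 3 - 20 * c ^ 2 - 24 * c + 36) * sq_eq hi hz hc hd +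
    (-4 * c ^ 3 - 4 * c ^ 2 - 24 * c * d + 68 * c - 8 * d) * cubic_eq hz hc

theorem quadratic_omega1_theta1_eq (hi : i ^ 2 = -1) (hz : IsPrimitiveRoot z 7)
    (hc : c = z + z ^ 6) (hd : d = i * (z - z ^ 6)) (T B : F) :
    (T - omega1 i z * B) ^ 2 - B ^ 2 * theta1 i z / 4 =
      (T ^ 2 - 2 * (6 * c ^ 2 + 2 * c - 13) * T * B + (4 * c ^ 2 + 4 * c - 11) * B ^ 2) +
        d * (4 * (c ^ 2 + c - 3) * T * B - 4 / 7 * (9 * c ^ 2 - c - 13) * B ^ 2) := by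
  linear_combination -2 * T * B * omega1_eq hz hc hd + B ^ 2 * omega1_sq_sub_theta1 hi hz hc hd

theorem quadratic_mul_conj (hi : i ^ 2 = -1) (hz : IsPrimitiveRoot z 7) (T B : F) :
    ((T - omega1 i z * B) ^ 2 - B ^ 2 * theta1 i z / 4) *
        ((T - omega1 (-i) z * B) ^ 2 - B ^ 2 * theta1 (-i) z / 4) =
      (T ^ 4 + 52 * T ^ 3 * B - 18 * T ^ 2 * B ^ 2 + 4 * T * B ^ 3 + 47 / 7 * B ^ 4) +
        (-8 * T ^ 3 * B + 8 * T ^ 2 * B ^ 2 + 8 * T * B ^ 3 + 72 / 7 * B ^ 4) * (z + z ^ 6) +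
        (-24 * T ^ 3 * B + 8 * T ^ 2 * B ^ 2 - 8 * T * B ^ 3 - 88 / 7 * B ^ 4) *
          (z + z ^ 6) ^ 2 := by
  have hd' : -(i * (z - z ^ 6)) = -i * (z - z ^ 6) := by ring
  rw [quadratic_omega1_theta1_eq hi hz rfl rfl,
    quadratic_omega1_theta1_eq (by rwa [neg_sq]) hz rfl hd']
  have hcubic := cubic_eq hz rfl
  have hsq := sq_eq hi hz rfl rfl
  generalize z + z ^ 6 = c at *
  generalize i * (z - z ^ 6) = d at *
  have hconj (α β : F) : (α + d * β) * (α + -d * β) = α ^ 2 - (4 - c ^ 2) * β ^ 2 := by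
    linear_combination -β ^ 2 * hsq
  rw [hconj]
  grind

end Cosine

section CharZero

/-- The coefficient of `t` in the remainder of `(t + 1)² t` modulo `(t - w)² - θ / 4`. A root `t`
of the latter polynomial can be recovered from `(t + 1)² t` when this coefficient does not
vanish. -/
def remainderCoeff (w θ : F) : F :=
  3 * w ^ 2 + 4 * w + 1 + θ / 4

variable [CharZero F]

theorem remainderCoeff_mul_eq {w θ t : F} (ht : (2 * (t - w)) ^ 2 = θ) :
    remainderCoeff w θ * t = (t + 1) ^ 2 * t + 2 * (w ^ 2 - θ / 4) * (w + 1) := by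
  rw [remainderCoeff]
  linear_combination -((t + 2 * w + 2) / 4) * ht

theorem eval_q7t_eq_prod_omega (hi : i ^ 2 = -1) (hz : IsPrimitiveRoot z 7) (T B : F) :
    (q7t B).eval T =
      7 * ∏ j : Fin 6, ((T - omega i z j * B) ^ 2 - B ^ 2 * theta i z j / 4) := by
  have hz₅ : IsPrimitiveRoot (z ^ 5) 7 := hz.pow_of_coprime 5 (by norm_num)
  have hz₃ : IsPrimitiveRoot (z ^ 3) 7 := hz.pow_of_coprime 3 (by norm_num)
  have hpairs (f : Fin 6 → F) : ∏ j, f j = f 0 * f 1 * (f 2 * f 3) * (f 4 * f 5) := by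
    rw [Fin.prod_univ_six]
    ring
  simp only [hpairs, omega, theta, Matrix.cons_val, omega3_eq_omega1 hz, omega5_eq_omega1 hz,
    theta3_eq_theta1 hz, theta5_eq_theta1 hz]
  rw [quadratic_mul_conj hi hz, quadratic_mul_conj hi hz₅, quadratic_mul_conj hi hz₃,
    prod_eq_cubicNorm hz]
  simp only [q7t, cubicNorm, eval_add, eval_sub, eval_mul, eval_pow, eval_X, eval_C, eval_ofNat]
  ring

theorem remainderCoeff_omega1_theta1_ne_zero (hi : i ^ 2 = -1) (hz : IsPrimitiveRoot z 7) :
    remainderCoeff (omega1 i z) (theta1 i z) ≠ 0 := by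
  obtain ⟨c, hc⟩ : ∃ c, c = z + z ^ 6 := ⟨_, rfl⟩
  obtain ⟨d, hd⟩ : ∃ d, d = i * (z - z ^ 6) := ⟨_, rfl⟩
  have hcubic := cubic_eq hz hc
  have hsq := sq_eq hi hz hc hd
  intro h
  have hlin : -524 * c ^ 2 - 316 * c + 1212 +
      d * (4 / 7 * (527 * c ^ 2 + 237 * c - 1119)) = 0 := by
    have hA : (2 * omega1 i z + 1) ^ 2 - (omega1 i z ^ 2 - theta1 i z / 4) = 0 := by
      rw [remainderCoeff] at h
      linear_combination h
    rw [omega1_sq_sub_theta1 hi hz hc hd, omega1_eq hz hc hd] at hA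
    linear_combination hA - 4 * (-2 * c ^ 2 - 2 * c + 6) ^ 2 * hsq -
      (-16 * c ^ 3 - 16 * c ^ 2 + 272 * c + d * (-96 * c - 32)) * hcubic
  -- The norm `α² - (4 - c²) β²` of `α + d β = 0` vanishes.
  have hnorm : 303 + (-65) * c + (-143) * c ^ 2 = 0 := by
    linear_combination 7 / 48 * (-524 * c ^ 2 - 316 * c + 1212 -
        d * (4 / 7 * (527 * c ^ 2 + 237 * c - 1119))) * hlin +
      (527 * c ^ 2 + 237 * c - 1119) ^ 2 / 21 * hsq -
      (8261856 - 12958320 * c - 446896 * c ^ 2 + 4443664 * c ^ 3) / 336 * hcubic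
  have hN := prod_eq_cubicNorm hz 303 (-65) (-143)
  rw [← hc, hnorm, zero_mul, zero_mul, cubicNorm] at hN
  norm_num at hN

theorem remainderCoeff_omega_theta_ne_zero (hi : i ^ 2 = -1) (hz : IsPrimitiveRoot z 7)
    (j : Fin 6) : remainderCoeff (omega i z j) (theta i z j) ≠ 0 := by
  have hi' : (-i) ^ 2 = -1 := by rwa [neg_sq]
  have hz₅ : IsPrimitiveRoot (z ^ 5) 7 := hz.pow_of_coprime 5 (by norm_num)
  have hz₃ : IsPrimitiveRoot (z ^ 3) 7 := hz.pow_of_coprime 3 (by norm_num)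
  fin_cases j <;>
    simp only [omega, theta, Matrix.cons_val, omega3_eq_omega1 hz, omega5_eq_omega1 hz,
      theta3_eq_theta1 hz, theta5_eq_theta1 hz, Fin.reduceFinMk, Fin.zero_eta, Fin.mk_one]
  exacts [remainderCoeff_omega1_theta1_ne_zero hi hz,
    remainderCoeff_omega1_theta1_ne_zero hi' hz,
    remainderCoeff_omega1_theta1_ne_zero hi hz₅,
    remainderCoeff_omega1_theta1_ne_zero hi' hz₅,
    remainderCoeff_omega1_theta1_ne_zero hi hz₃,
    remainderCoeff_omega1_theta1_ne_zero hi' hz₃]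

theorem eval_q7t_eq_zero_of_radical (hi : i ^ 2 = -1) (hz : IsPrimitiveRoot z 7) (B : F)
    {j : Fin 6} {t : F} (ht : (2 * (t - omega i z j)) ^ 2 = theta i z j) :
    (q7t B).eval (t * B) = 0 := by
  rw [eval_q7t_eq_prod_omega hi hz, Finset.prod_eq_zero (Finset.mem_univ j), mul_zero]
  linear_combination B ^ 2 / 4 * ht

theorem map_q7t_eq_prod {K : Type*} [Field K] [Algebra K F] (hi : i ^ 2 = -1)
    (hz : IsPrimitiveRoot z 7) (b : K) (r : Fin 6 → F) (hr : ∀ j, r j ^ 2 = theta i z j) :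
    (q7t b).map (algebraMap K F) =
      7 * ∏ j : Fin 6,
        ((X - C (omega i z j * algebraMap K F b + 1 / 2 * algebraMap K F b * r j)) *
          (X - C (omega i z j * algebraMap K F b - 1 / 2 * algebraMap K F b * r j))) := by
  refine Polynomial.funext fun T => ?_
  rw [map_q7t, eval_q7t_eq_prod_omega hi hz, eval_mul, eval_prod, eval_ofNat]
  congr 1
  refine Finset.prod_congr rfl fun j _ => ?_
  simp only [eval_mul, eval_sub, eval_X, eval_C]
  linear_combination (algebraMap K F b) ^ 2 / 4 * hr j

end CharZero

end Constants

section DivisionField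

variable {K : Type*} [Field K] {b : K} {L : Type*} [Field L] [Algebra K L]
  {i z : L}

theorem X_mem_of_radical [CharZero L] {M : IntermediateField K L} (hb : b ≠ 0)
    (hi : i ^ 2 = -1) (hz : IsPrimitiveRoot z 7) {j : Fin 6} {t x y : L}
    (hiM : i ∈ M) (hzM : z ∈ M) (hyM : y ∈ M)
    (ht : (2 * (t - omega i z j)) ^ 2 = theta i z j) (hx : x ^ 2 = t * algebraMap K L b)
    (hy : y ^ 2 = (t + 1) * algebraMap K L b * x) (hy0 : y ≠ 0) :
    x ∈ M := by
  have hβ : algebraMap K L b ≠ 0 := (_root_.map_ne_zero _).mpr hb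
  have hω : omega i z j ∈ M :=
    map_omega (algebraMap M L) ⟨i, hiM⟩ ⟨z, hzM⟩ j ▸ SetLike.coe_mem _
  have hθ : theta i z j ∈ M :=
    map_theta (algebraMap M L) ⟨i, hiM⟩ ⟨z, hzM⟩ j ▸ SetLike.coe_mem _
  have hA := remainderCoeff_omega_theta_ne_zero hi hz j
  have hAt := remainderCoeff_mul_eq ht
  have hy4 : (t + 1) ^ 2 * t = y ^ 4 / algebraMap K L b ^ 3 := by
    rw [eq_div_iff (pow_ne_zero 3 hβ)]
    linear_combination -(y ^ 2 + (t + 1) * algebraMap K L b * x) * hy -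
      (t + 1) ^ 2 * algebraMap K L b ^ 2 * hx
  generalize omega i z j = w at *
  generalize theta i z j = θ at *
  lift w to M using hω
  lift θ to M using hθ
  lift y to M using hyM
  have hcoe : ((remainderCoeff w θ : M) : L) = remainderCoeff (w : L) θ := rfl
  have ht_eq : t = (((y ^ 4 / algebraMap K M b ^ 3 + 2 * (w ^ 2 - θ / 4) * (w + 1)) /
      remainderCoeff w θ : M) : L) := by
    push_cast [hcoe]
    rw [eq_div_iff hA, mul_comm, hAt, hy4]
    rfl
  lift t to M using ht_eq ▸ SetLike.coe_mem _
  have hx_eq : x = ((y ^ 2 / ((t + 1) * algebraMap K M b) : M) : L) := by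
    have hy2 : (y : L) ^ 2 ≠ 0 := pow_ne_zero 2 hy0
    push_cast
    rw [hy] at hy2 ⊢
    exact (mul_div_cancel_left₀ x (left_ne_zero_of_mul hy2)).symm
  exact hx_eq ▸ SetLike.coe_mem _

variable [DecidableEq L]

theorem X_mem_divisionField {m : ℕ} {x y : L}
    {h : ((curve b).baseChange L).toAffine.Nonsingular x y}
    (hP : m • (Point.some x y h : Pt b L) = 0) : x ∈ divisionField b L m :=
  IntermediateField.subset_adjoin _ _ ⟨x, y, h, hP, .inl rfl⟩

theorem Y_mem_divisionField {m : ℕ} {x y : L}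
    {h : ((curve b).baseChange L).toAffine.Nonsingular x y}
    (hP : m • (Point.some x y h : Pt b L) = 0) : y ∈ divisionField b L m :=
  IntermediateField.subset_adjoin _ _ ⟨x, y, h, hP, .inr rfl⟩

theorem i_mem_divisionField (hi : i ^ 2 = -1) {m : ℕ} {x y : L}
    {h : ((curve b).baseChange L).toAffine.Nonsingular x y}
    (hP : m • (Point.some x y h : Pt b L) = 0) (hy : y ≠ 0) : i ∈ divisionField b L m := by
  have hcm : m • cmHom b hi (Point.some x y h) = 0 := by rw [← map_nsmul, hP, map_zero]
  have hiy : i * y ∈ divisionField b L m := Y_mem_divisionField hcm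
  simpa [hy] using div_mem hiy (Y_mem_divisionField hP)

theorem Y_ne_zero_of_addOrderOf_eq_seven {x y : L}
    {h : ((curve b).baseChange L).toAffine.Nonsingular x y}
    (hP : addOrderOf (Point.some x y h : Pt b L) = 7) : y ≠ 0 := by
  rintro rfl
  have h2 := addOrderOf_dvd_of_nsmul_eq_zero (two_nsmul_some_of_Y_eq_zero h)
  rw [hP] at h2
  norm_num at h2

theorem mem_of_some_eq_nsmul_add_nsmul_cm (M : IntermediateField K L)
    (hi : i ^ 2 = -1) (hiM : i ∈ M) {x y x' y' : L} (hx : x ∈ M) (hy : y ∈ M)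
    {h : ((curve b).baseChange L).toAffine.Nonsingular x y}
    {h' : ((curve b).baseChange L).toAffine.Nonsingular x' y'} {m n : ℕ}
    (heq : (Point.some x' y' h' : Pt b L) =
      m • (Point.some x y h : Pt b L) + n • cm b i hi (Point.some x y h)) :
    x' ∈ M ∧ y' ∈ M := by
  classical
  have hns : ((curve b).baseChange M).toAffine.Nonsingular (⟨x, hx⟩ : M) ⟨y, hy⟩ :=
    ((curve b).toAffine.baseChange_nonsingular (f := M.val) Subtype.val_injective _ _).mp h
  have hiM' : (⟨i, hiM⟩ : M) ^ 2 = -1 := Subtype.ext hi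
  let P : Pt b M := Point.some _ _ hns
  have hmap : Point.map (W' := (curve b).toAffine) M.val (m • P + n • cm b _ hiM' P) =
      Point.some x' y' h' := by
    rw [heq, map_add, map_nsmul, map_nsmul]
    rfl
  cases hR : m • P + n • cm b _ hiM' P with
  | zero =>
    rw [hR] at hmap
    cases hmap
  | some u v huv =>
    rw [hR, Point.map_some, Point.some.injEq] at hmap
    exact ⟨hmap.1 ▸ u.2, hmap.2 ▸ v.2⟩

variable [CharZero L]

theorem exists_addOrderOf_eq_seven_of_radical (hb : b ≠ 0) (hi : i ^ 2 = -1)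
    (hz : IsPrimitiveRoot z 7) {j : Fin 6} {t x y : L}
    (ht : (2 * (t - omega i z j)) ^ 2 = theta i z j) (hx : x ^ 2 = t * algebraMap K L b)
    (hy : y ^ 2 = (t + 1) * algebraMap K L b * x) :
    ∃ h : ((curve b).baseChange L).toAffine.Nonsingular x y,
      addOrderOf (Point.some x y h : Pt b L) = 7 := by
  have h : ((curve b).baseChange L).toAffine.Nonsingular x y :=
    nonsingular_curve_of_equation two_ne_zero hb (by linear_combination hy - x * hx)
  refine ⟨h, (addOrderOf_some_eq_seven_iff two_ne_zero hb h).mpr ?_⟩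
  rw [aeval_q7, hx]
  exact eval_q7t_eq_zero_of_radical hi hz _ ht

variable [IsAlgClosed L]

theorem omega_mem_divisionField (hb : b ≠ 0) (hi : i ^ 2 = -1) (hz : IsPrimitiveRoot z 7)
    (j : Fin 6) : omega i z j ∈ divisionField b L 7 := by
  have hβ : algebraMap K L b ≠ 0 := (_root_.map_ne_zero _).mpr hb
  obtain ⟨r, hr⟩ := IsAlgClosed.exists_pow_nat_eq (theta i z j) two_pos
  have hmem (t : L) (ht : (2 * (t - omega i z j)) ^ 2 = theta i z j) :
      t * algebraMap K L b ∈ divisionField b L 7 := by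
    obtain ⟨x, hx⟩ := IsAlgClosed.exists_pow_nat_eq (t * algebraMap K L b) two_pos
    obtain ⟨y, hy⟩ := IsAlgClosed.exists_pow_nat_eq ((t + 1) * algebraMap K L b * x) two_pos
    obtain ⟨h, hP⟩ := exists_addOrderOf_eq_seven_of_radical hb hi hz ht hx hy
    rw [← hx]
    exact pow_mem (X_mem_divisionField (hP ▸ addOrderOf_nsmul_eq_zero _)) 2
  have hadd := hmem (omega i z j + r / 2) (by linear_combination hr)
  have hsub := hmem (omega i z j - r / 2) (by linear_combination hr)
  have h2β : 2 * algebraMap K L b ∈ divisionField b L 7 :=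
    mul_mem (ofNat_mem _ 2) (IntermediateField.algebraMap_mem _ b)
  convert div_mem (add_mem hadd hsub) h2β using 1
  field_simp
  ring

theorem root_of_unity_mem_divisionField (hb : b ≠ 0) (hi : i ^ 2 = -1)
    (hz : IsPrimitiveRoot z 7) (hiD : i ∈ divisionField b L 7) : z ∈ divisionField b L 7 := by
  choose w hw using fun j => CanLift.prf (β := divisionField b L 7) _
    (omega_mem_divisionField hb hi hz j)
  lift i to divisionField b L 7 using hiD
  have hz_eq : z = (((2 - 55 * i) * w 0 + (2 + 55 * i) * w 1 + (-20 + 33 * i) * w 2 +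
      (-20 - 33 * i) * w 3 + (46 - 11 * i) * w 4 + (46 + 11 * i) * w 5) / 1232 :
        divisionField b L 7) := by
    push_cast
    simp only [hw]
    rw [eq_div_iff (by norm_num), mul_comm]
    exact eq_linear_combination_omega hi
  rw [hz_eq]
  exact SetLike.coe_mem _

theorem divisionField_seven_eq_adjoin (hb : b ≠ 0) (hi : i ^ 2 = -1) (hz : IsPrimitiveRoot z 7)
    {j : Fin 6} {t x y : L} (ht : (2 * (t - omega i z j)) ^ 2 = theta i z j)
    (hx : x ^ 2 = t * algebraMap K L b) (hy : y ^ 2 = (t + 1) * algebraMap K L b * x) :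
    divisionField b L 7 = IntermediateField.adjoin K {i, z, y} := by
  obtain ⟨h, hP⟩ := exists_addOrderOf_eq_seven_of_radical hb hi hz ht hx hy
  apply le_antisymm
  · have hsub := IntermediateField.subset_adjoin K ({i, z, y} : Set L)
    have hiM : i ∈ IntermediateField.adjoin K {i, z, y} := hsub (by simp)
    have hzM : z ∈ IntermediateField.adjoin K {i, z, y} := hsub (by simp)
    have hyM : y ∈ IntermediateField.adjoin K {i, z, y} := hsub (by simp)
    have hxM := X_mem_of_radical hb hi hz hiM hzM hyM ht hx hy
      (Y_ne_zero_of_addOrderOf_eq_seven hP)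
    refine IntermediateField.adjoin_le_iff.mpr ?_
    rintro c ⟨x', y', h', h7, hc⟩
    obtain ⟨m, hm, -⟩ :=
      (seven_nsmul_eq_zero_iff_existsUnique_cm two_ne_zero hb hi hP _).mp h7
    have := mem_of_some_eq_nsmul_add_nsmul_cm _ hi hiM hxM hyM hm
    rcases hc with rfl | rfl
    exacts [this.1, this.2]
  · have h7 : 7 • (Point.some x y h : Pt b L) = 0 := hP ▸ addOrderOf_nsmul_eq_zero _
    have hiD := i_mem_divisionField hi h7 (Y_ne_zero_of_addOrderOf_eq_seven hP)
    have hzD := root_of_unity_mem_divisionField hb hi hz hiD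
    have hyD := Y_mem_divisionField h7
    refine IntermediateField.adjoin_le_iff.mpr ?_
    rintro c (rfl | rfl | rfl)
    exacts [hiD, hzD, hyD]

end DivisionField

end SevenDivision

end

open Polynomial SevenDivision in
theorem theorem1_general {K : Type*} [Field K] {L : Type*} [Field L] [DecidableEq L] [CharZero L]
    [Algebra K L] [IsAlgClosed L]
    (b : K) (hb : b ≠ 0)
    (i ζ : L) (hi : i ^ 2 = -1) (hζ : IsPrimitiveRoot ζ 7) :
    (∀ (j : Fin 6) (ε : ℤˣ) (r x y : L),
      r ^ 2 = theta i ζ j →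
      x ^ 2 = omega i ζ j * algebraMap K L b + ((ε : ℤ) : L) * (1 / 2) * algebraMap K L b * r →
      y ^ 2 = (omega i ζ j + ((ε : ℤ) : L) * (1 / 2) * r + 1) * algebraMap K L b * x →
      (∃ h : ((curve b).baseChange L).toAffine.Nonsingular x y,
        addOrderOf (WeierstrassCurve.Affine.Point.some x y h : Pt b L) = 7) ∧
      divisionField b L 7 = IntermediateField.adjoin K {i, ζ, y}) ∧
    (curve b).preΨ' 7 = q7 b ∧
    (∀ (x y : L) (h : ((curve b).baseChange L).toAffine.Nonsingular x y),
      7 • (WeierstrassCurve.Affine.Point.some x y h : Pt b L) = 0 ↔ aeval x (q7 b) = 0) ∧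
    (∀ r : Fin 6 → L, (∀ j, r j ^ 2 = theta i ζ j) →
      (q7t b).map (algebraMap K L) =
        7 * ∏ j : Fin 6,
          ((X - C (omega i ζ j * algebraMap K L b + 1 / 2 * algebraMap K L b * r j)) *
            (X - C (omega i ζ j * algebraMap K L b - 1 / 2 * algebraMap K L b * r j)))) ∧
    (∀ P : Pt b L, addOrderOf P = 7 → ∀ Q : Pt b L,
      7 • Q = 0 ↔ ∃! c : Fin 7 × Fin 7, Q = (c.1 : ℕ) • P + (c.2 : ℕ) • cm b i hi P) := by
  refine ⟨fun j ε r x y hr hx hy => ?_, preΨ'_seven_curve b,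
    fun x y h => seven_nsmul_some_eq_zero_iff two_ne_zero hb h,
    fun r hr => map_q7t_eq_prod hi hζ b r hr,
    fun P hP Q => seven_nsmul_eq_zero_iff_existsUnique_cm two_ne_zero hb hi hP Q⟩
  have ht : (2 * (omega i ζ j + ((ε : ℤ) : L) * (1 / 2) * r - omega i ζ j)) ^ 2 =
      theta i ζ j := by
    have hε : ((ε : ℤ) : L) ^ 2 = 1 := by rcases Int.units_eq_one_or ε with rfl | rfl <;> simp
    linear_combination r ^ 2 * hε + hr
  have hxt : x ^ 2 = (omega i ζ j + ((ε : ℤ) : L) * (1 / 2) * r) * algebraMap K L b := by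
    linear_combination hx
  exact ⟨exists_addOrderOf_eq_seven_of_radical hb hi hζ ht hxt hy,
    divisionField_seven_eq_adjoin hb hi hζ ht hxt hy⟩

open Polynomial SevenDivision in
theorem theorem1 {K : Type*} [Field K] [NumberField K]
    {L : Type*} [Field L] [DecidableEq L] [Algebra K L] [IsAlgClosure K L]
    (b : K) (hb : b ≠ 0)
    (i ζ : L) (hi : i ^ 2 = -1) (hζ : IsPrimitiveRoot ζ 7) :
    -- the points with the nested radicals as coordinates have order 7, and `K₇ = K(i, ζ₇, y)`,
    -- for every choice of the square roots `r`, `x`, `y`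
    (∀ (j : Fin 6) (ε : ℤˣ) (r x y : L),
      r ^ 2 = theta i ζ j →
      x ^ 2 = omega i ζ j * algebraMap K L b + ((ε : ℤ) : L) * (1 / 2) * algebraMap K L b * r →
      y ^ 2 = (omega i ζ j + ((ε : ℤ) : L) * (1 / 2) * r + 1) * algebraMap K L b * x →
      (∃ h : ((curve b).baseChange L).toAffine.Nonsingular x y,
        addOrderOf (WeierstrassCurve.Affine.Point.some x y h : Pt b L) = 7) ∧
      divisionField b L 7 = IntermediateField.adjoin K {i, ζ, y}) ∧
    -- `q₇` is the 7-division polynomial: its roots are the abscissas of the points of order 7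
    (curve b).preΨ' 7 = q7 b ∧
    (∀ (x y : L) (h : ((curve b).baseChange L).toAffine.Nonsingular x y),
      7 • (WeierstrassCurve.Affine.Point.some x y h : Pt b L) = 0 ↔ aeval x (q7 b) = 0) ∧
    -- its factorisation in `t = x²`
    (∀ r : Fin 6 → L, (∀ j, r j ^ 2 = theta i ζ j) →
      (q7t b).map (algebraMap K L) =
        7 * ∏ j : Fin 6,
          ((X - C (omega i ζ j * algebraMap K L b + 1 / 2 * algebraMap K L b * r j)) *
            (X - C (omega i ζ j * algebraMap K L b - 1 / 2 * algebraMap K L b * r j)))) ∧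
    -- `{P, φ₁(P)}` is a basis of `E₁[7]` over `ℤ/7ℤ` for every point `P` of order 7
    (∀ P : Pt b L, addOrderOf P = 7 → ∀ Q : Pt b L,
      7 • Q = 0 ↔ ∃! c : Fin 7 × Fin 7, Q = (c.1 : ℕ) • P + (c.2 : ℕ) • cm b i hi P) := by
  have : IsAlgClosed L := IsAlgClosure.isAlgClosed K
  have : CharZero L := charZero_of_injective_algebraMap (algebraMap K L).injective
  exact theorem1_general b hb i ζ hi hζ
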